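/- Let $\mathbb{Z}^N$ carry the standard lattice graph structure, $x\sim y$ iff $\sum_i|x_i-y_i|=1$, and let $\Delta u(x)=\sum_{y\sim x}(u(y)-u(x))$ and $|\nabla u|^2(x)=\frac12\sum_{y\sim x}(u(y)-u(x))^2$ for $u:\mathbb{Z}^N\to\mathbb{R}$. Let $V:\mathbb{Z}^N\to\mathbb{R}$ satisfy the following: there are an integer $T\ge 1$ and a $T$-periodic function $V_p:\mathbb{Z}^N\to\mathbb{R}$ (that is, $V_p(x+Te_i)=V_p(x)$ for all $x\in\mathbb{Z}^N$ and $1\le i\le N$) such that $$-1<\inf_{\mathbb{Z}^N}V\le V(x)\le V_p(x)\quad\text{for all }x\in\mathbb{Z}^N,\qquad |V(x)-V_p(x)|\to0\ \text{ as }|x|\to\infty .$$ Then the logarithmic Schrödinger equation $$-\Delta u+V(x)u=u\log u^2,\qquad x\in\mathbb{Z}^N \quad(\text{with } 0\log 0=0),$$ has a ground state solution $u$ such that either $u(x)>0$ for all $x\in\mathbb{Z}^N$ or $u(x)<0$ for all $x\in\mathbb{Z}^N$. Here $H^1(\mathbb{Z}^N)$ is the completion of the finitely supported functions under the norm $\left(\sum_x(|\nabla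 u|^2+u^2)\right)^{1/2}$, $X=\{u\in H^1(\mathbb{Z}^N):\sum_x(V+1)u^2<\infty\}$, the energy $J:X\to(-\infty,+\infty]$ is $$J(u)=\frac12\sum_{x}\left(|\nabla u|^2+(V+1)u^2\right)-\frac12\sum_{x}u^2\log u^2,$$ $D(J)=\{u\in X:J(u)<+\infty\}$, and the Nehari manifold is $$\mathcal N=\Big\{u\in D(J)\setminus\{0\}:\ \sum_x\left(|\nabla u|^2+Vu^2\right)-\sum_x u^2\log u^2=0\Big\}.$$ A ground state solution is a function $u\in\mathcal N$ that solves the equation at every point of $\mathbb{Z}^N$ and satisfies $J(u)=\inf_{\mathcal N}J$. -/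

import Mathlib

noncomputable section

namespace LogSchrodinger

open scoped ENNReal

/-- The standard lattice graph on `ℤ^N`: `x ∼ y` iff `∑ i, |x i - y i| = 1`. -/
def latticeGraph (N : ℕ) : SimpleGraph (Fin N → ℤ) where
  Adj x y := ∑ i, |x i - y i| = 1
  symm := ⟨fun x y h => by simpa only [abs_sub_comm] using h⟩
  loopless := ⟨fun x h => by simp at h⟩

theorem neighborSet_finite (N : ℕ) (x : Fin N → ℤ) :
    ((latticeGraph N).neighborSet x).Finite := by
  refine (Set.finite_Icc (x - 1) (x + 1)).subset fun y hy => ?_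
  have hy' : ∑ i, |x i - y i| = 1 := hy
  have key : ∀ i, |x i - y i| ≤ 1 := fun i =>
    hy' ▸ Finset.single_le_sum (f := fun i => |x i - y i|)
      (fun j _ => abs_nonneg _) (Finset.mem_univ i)
  refine ⟨fun i => ?_, fun i => ?_⟩
  · have h := abs_le.1 (key i)
    simp only [Pi.sub_apply, Pi.one_apply]
    omega
  · have h := abs_le.1 (key i)
    simp only [Pi.add_apply, Pi.one_apply]
    omega

instance latticeGraphLocallyFinite (N : ℕ) : (latticeGraph N).LocallyFinite :=
  fun x => (neighborSet_finite N x).fintype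

variable {N : ℕ}

/-- The graph Laplacian `Δu(x) = ∑_{y ∼ x} (u(y) - u(x))`. -/
def laplacian (u : (Fin N → ℤ) → ℝ) (x : Fin N → ℤ) : ℝ :=
  ∑ y ∈ (latticeGraph N).neighborFinset x, (u y - u x)

/-- `|∇u|²(x) = ½ ∑_{y ∼ x} (u(y) - u(x))²`. -/
def gradSq (u : (Fin N → ℤ) → ℝ) (x : Fin N → ℤ) : ℝ :=
  (1 / 2) * ∑ y ∈ (latticeGraph N).neighborFinset x, (u y - u x) ^ 2

/-- The squared norm of `H¹(ℤ^N)`, `‖u‖² = ∑_x (|∇u|²(x) + u(x)²)`, with value in `[0, ∞]`. -/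
def h1NormSq (u : (Fin N → ℤ) → ℝ) : ℝ≥0∞ :=
  ∑' x, ENNReal.ofReal (gradSq u x + u x ^ 2)

/-- Membership in `H¹(ℤ^N)`, the completion of the finitely supported functions under the `H¹` norm,
realised as a space of functions: `u` is approximated in this norm by finitely supported functions. -/
def MemH1 (u : (Fin N → ℤ) → ℝ) : Prop :=
  ∀ ε : ℝ≥0∞, 0 < ε → ∃ φ : (Fin N → ℤ) → ℝ, φ.support.Finite ∧ h1NormSq (u - φ) < ε

/-- Membership in `X = {u ∈ H¹(ℤ^N) : ∑_x (V(x) + 1) u(x)² < ∞}` (used for `V > -1`). -/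
def MemX (V u : (Fin N → ℤ) → ℝ) : Prop :=
  MemH1 u ∧ ∑' x, ENNReal.ofReal ((V x + 1) * u x ^ 2) < ⊤

open Classical in
/-- The energy functional
`J(u) = ½ ∑_x (|∇u|² + (V + 1) u²) - ½ ∑_x u² log u²`, with values in `(-∞, +∞]`.
A function `u ∈ X` is square summable, so `u(x)² log u(x)² > 0` at finitely many points only; hence
either the last series converges absolutely or its sum is `-∞`, and in this second case
`J(u) = +∞`. Outside `X` the value is `+∞` by convention. Here `0 log 0 = 0`. -/
def energy (V u : (Fin N → ℤ) → ℝ) : EReal :=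
  if MemX V u ∧ Summable (fun x => u x ^ 2 * Real.log (u x ^ 2)) then
    (((1 / 2) * ∑' x, (gradSq u x + (V x + 1) * u x ^ 2)
      - (1 / 2) * ∑' x, u x ^ 2 * Real.log (u x ^ 2) : ℝ) : EReal)
  else ⊤

/-- The effective domain `D(J) = {u ∈ X : J(u) < +∞}`. -/
def domain (V : (Fin N → ℤ) → ℝ) : Set ((Fin N → ℤ) → ℝ) :=
  {u | MemX V u ∧ energy V u < ⊤}

/-- `⟨J'(u), u⟩ = ∑_x (|∇u|² + V u²) - ∑_x u² log u²`, for `u ∈ D(J)`. -/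
def derivPairing (V u : (Fin N → ℤ) → ℝ) : ℝ :=
  ∑' x, (gradSq u x + V x * u x ^ 2) - ∑' x, u x ^ 2 * Real.log (u x ^ 2)

/-- The Nehari manifold `{u ∈ D(J) \ {0} : ⟨J'(u), u⟩ = 0}`. -/
def nehari (V : (Fin N → ℤ) → ℝ) : Set ((Fin N → ℤ) → ℝ) :=
  {u | u ∈ domain V ∧ u ≠ 0 ∧ derivPairing V u = 0}

/-- The ground state level `inf {J(u) : u in the Nehari manifold}`. -/
def nehariLevel (V : (Fin N → ℤ) → ℝ) : EReal :=
  ⨅ u ∈ nehari V, energy V u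

/-- `u` solves `-Δu + V u = u log u²` at every point of `ℤ^N` (with `0 log 0 = 0`). -/
def IsSolution (V u : (Fin N → ℤ) → ℝ) : Prop :=
  ∀ x, -laplacian u x + V x * u x = u x * Real.log (u x ^ 2)

/-- A ground state solution: a nontrivial solution of finite energy, lying on the Nehari manifold
and attaining the infimum of the energy there. -/
def IsGroundState (V u : (Fin N → ℤ) → ℝ) : Prop :=
  IsSolution V u ∧ u ∈ nehari V ∧ energy V u = nehariLevel V

/-- `g` is `T`-periodic: `g(x + T e_i) = g(x)` for all `x` and all coordinate directions `i`. -/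
def IsPeriodic (T : ℕ) (g : (Fin N → ℤ) → ℝ) : Prop :=
  ∀ (x : Fin N → ℤ) (i : Fin N), g (x + (T : ℤ) • Pi.single i 1) = g x

end LogSchrodinger

end

noncomputable section

namespace LogSchrodinger

open scoped ENNReal
open Filter Topology

variable {N : ℕ}

/-! Write `E(u) = ∑ dens V u = 2 J(u)`. Only the entropy term is inhomogeneous, so `E(cu) = c² E(u)
- c² log c² ‖u‖²` with the `ℓ²` norm (`dens_smul`), and the Nehari condition reads `E(u) = ‖u‖²`.
Let `m` be the infimum of `E` over the unit sphere of `ℓ²`, where all densities are nonnegative.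
Scaling gives `E ≥ s m - s log s` at mass `s` (`le_hasSum_dens`). Hence Nehari functions have mass
at least `exp (m - 1)`, with equality for `exp ((m - 1) / 2)` times a minimiser on the sphere, and
it remains to find such a minimiser.

Take a nonnegative minimising sequence. The entropy rules out vanishing (`exists_exp_le_sq`), so
after translation the values at the origin stay away from zero. Along an ultrafilter the translates
converge pointwise to some `w ≠ 0` of mass `s ≤ 1`, and the translated potentials to some `W` lying
above a translate of `V` (`exists_limit_potential`). Cut along a finite set: the outer part costs at
least `m` times its mass, which forces `E_W(w) ≤ m s` (`sphereEnergy_le_of_tendsto`). Since `s ≤ 1`,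
normalising `w` gives energy at most `m`, and replacing `W` by the translate of `V` only lowers it.
Neither strong convergence nor a comparison with the periodic level is needed.

Variations at single sites give the Euler–Lagrange equation, whose multiplier `m - 1` is absorbed by
the dilation. At a zero of a nonnegative solution the equation annihilates all neighbours, so
connectedness of the lattice gives positivity. -/

/-! ### Unit steps, periodicity and connectedness of the lattice. -/

/-- The neighbours of the origin, i.e. the unit steps of the lattice. -/
def steps (N : ℕ) : Finset (Fin N → ℤ) := (latticeGraph N).neighborFinset 0

theorem mem_steps {d : Fin N → ℤ} : d ∈ steps N ↔ ∑ i, |d i| = 1 := by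
  rw [steps, SimpleGraph.mem_neighborFinset]
  change ∑ i, |(0 : Fin N → ℤ) i - d i| = 1 ↔ _
  simp

theorem neg_mem_steps {d : Fin N → ℤ} (h : d ∈ steps N) : -d ∈ steps N := by
  rw [mem_steps] at h ⊢
  simpa using h

theorem single_mem_steps (i : Fin N) : (Pi.single i 1 : Fin N → ℤ) ∈ steps N := by
  rw [mem_steps, Finset.sum_eq_single i] <;> simp +contextual

theorem sum_neighborFinset {R : Type*} [AddCommMonoid R] (f : (Fin N → ℤ) → R) (x : Fin N → ℤ) :
    ∑ y ∈ (latticeGraph N).neighborFinset x, f y = ∑ d ∈ steps N, f (x + d) := by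
  refine Finset.sum_nbij' (fun y => y - x) (fun d => x + d) ?_ ?_ ?_ ?_ ?_
  · intro y hy
    rw [SimpleGraph.mem_neighborFinset] at hy
    have hy' : ∑ i, |x i - y i| = 1 := hy
    rw [mem_steps]
    simpa [abs_sub_comm] using hy'
  · intro d hd
    rw [SimpleGraph.mem_neighborFinset]
    change ∑ i, |x i - (x + d) i| = 1
    rw [mem_steps] at hd
    simpa using hd
  · intro y _; simp
  · intro d _; simp
  · intro y _; simp

theorem sum_steps_neg {R : Type*} [AddCommMonoid R] (f : (Fin N → ℤ) → R) :
    ∑ d ∈ steps N, f (-d) = ∑ d ∈ steps N, f d :=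
  Finset.sum_nbij' (fun d => -d) (fun d => -d) (fun _ h => neg_mem_steps h)
    (fun _ h => neg_mem_steps h) (by simp) (by simp) (by simp)

theorem laplacian_eq (u : (Fin N → ℤ) → ℝ) (x : Fin N → ℤ) :
    laplacian u x = ∑ d ∈ steps N, (u (x + d) - u x) :=
  sum_neighborFinset (fun y => u y - u x) x

theorem gradSq_eq (u : (Fin N → ℤ) → ℝ) (x : Fin N → ℤ) :
    gradSq u x = (1 / 2) * ∑ d ∈ steps N, (u (x + d) - u x) ^ 2 := by
  rw [gradSq, sum_neighborFinset (fun y => (u y - u x) ^ 2) x]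

theorem gradSq_nonneg (u : (Fin N → ℤ) → ℝ) (x : Fin N → ℤ) : 0 ≤ gradSq u x := by
  rw [gradSq_eq]; positivity

theorem sum_smul_single (z : Fin N → ℤ) :
    z = ∑ i, z i • (Pi.single i 1 : Fin N → ℤ) := by
  ext j
  simp [Finset.sum_apply, Pi.single_apply]

theorem IsPeriodic.add_smul {T : ℕ} {g : (Fin N → ℤ) → ℝ} (hg : IsPeriodic T g)
    (z x : Fin N → ℤ) : g (x + (T : ℤ) • z) = g x := by
  have h : Function.Periodic g ((T : ℤ) • z) := by
    rw [sum_smul_single z, Finset.smul_sum]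
    refine Finset.sum_induction _ (Function.Periodic g) (fun a b ha hb => ha.add_period hb)
      (fun x => by simp) fun i _ => ?_
    rw [smul_comm]
    exact Function.Periodic.zsmul (fun x => hg x i) _
  exact h x

/-- A property of sites that is inherited by neighbours holds everywhere once it holds somewhere. -/
theorem forall_of_steps {p : (Fin N → ℤ) → Prop} (h : ∀ x, p x → ∀ d ∈ steps N, p (x + d))
    {z : Fin N → ℤ} (hz : p z) (x : Fin N → ℤ) : p x := by
  have h1 : ∀ w : Fin N → ℤ, ∀ x, p x ↔ p (x + w) := by
    intro w
    rw [sum_smul_single w]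
    refine Finset.sum_induction _ (fun w => ∀ x, p x ↔ p (x + w)) ?_ (by simp) ?_
    · intro a b ha hb x
      rw [ha x, hb (x + a), add_assoc]
    · intro i _
      have hs : ∀ x, p x ↔ p (x + Pi.single i 1) := fun x =>
        ⟨fun hx => h x hx _ (single_mem_steps i), fun hx => by
          simpa using h _ hx _ (neg_mem_steps (single_mem_steps i))⟩
      induction w i using Int.induction_on with
      | zero => simp
      | succ k ih =>
        intro x
        rw [add_smul, one_smul, ← add_assoc, ← hs, ← ih]
      | pred k ih =>
        intro x
        rw [ih x, hs (x + (-(k : ℤ) - 1) • Pi.single i 1), add_assoc, sub_smul, one_smul,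
          sub_add_cancel]
  simpa using (h1 (x - z) z).1 hz

/-! ### Energy density, scaling and the level on the unit sphere. -/

/-- The nonnegative energy density on the unit sphere of `ℓ²`. -/
def dens (V u : (Fin N → ℤ) → ℝ) (x : Fin N → ℤ) : ℝ :=
  gradSq u x + (V x + 1) * u x ^ 2 + Real.negMulLog (u x ^ 2)

/-- The sum of the energy density, as an extended nonnegative real. -/
def sphereEnergy (V u : (Fin N → ℤ) → ℝ) : ℝ≥0∞ := ∑' x, ENNReal.ofReal (dens V u x)

/-- The infimum of the energy over the unit sphere of `ℓ²`. -/
def sphereLevel (V : (Fin N → ℤ) → ℝ) : ℝ≥0∞ :=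
  ⨅ u, ⨅ _ : HasSum (fun x => u x ^ 2) 1, sphereEnergy V u

theorem sq_le_of_hasSum {u : (Fin N → ℤ) → ℝ} {s : ℝ} (h : HasSum (fun x => u x ^ 2) s)
    (x : Fin N → ℤ) : u x ^ 2 ≤ s :=
  le_hasSum h x fun _ _ => sq_nonneg _

theorem dens_nonneg {V u : (Fin N → ℤ) → ℝ} (hV : ∀ x, -1 < V x) {x : Fin N → ℤ}
    (h : u x ^ 2 ≤ 1) : 0 ≤ dens V u x := by
  have h1 := gradSq_nonneg u x
  have h2 : 0 ≤ (V x + 1) * u x ^ 2 := mul_nonneg (by linarith [hV x]) (sq_nonneg _)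
  have h3 := Real.negMulLog_nonneg (sq_nonneg (u x)) h
  unfold dens; linarith

theorem gradSq_smul (c : ℝ) (u : (Fin N → ℤ) → ℝ) (x : Fin N → ℤ) :
    gradSq (c • u) x = c ^ 2 * gradSq u x := by
  simp only [gradSq_eq, Pi.smul_apply, smul_eq_mul, ← mul_sub, mul_pow, ← Finset.mul_sum]
  ring

/-- All terms are quadratic except the entropy, where `log (c² u²)` splits; the error is a multiple
of the mass density. -/
theorem dens_smul (V : (Fin N → ℤ) → ℝ) (c : ℝ) (u : (Fin N → ℤ) → ℝ) (x : Fin N → ℤ) :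
    dens V (c • u) x = c ^ 2 * dens V u x + Real.negMulLog (c ^ 2) * u x ^ 2 := by
  simp only [dens, gradSq_smul, Pi.smul_apply, smul_eq_mul, mul_pow, Real.negMulLog_mul]
  ring

theorem gradSq_add_right (u : (Fin N → ℤ) → ℝ) (x y : Fin N → ℤ) :
    gradSq (fun x => u (x + y)) x = gradSq u (x + y) := by
  simp only [gradSq_eq, add_right_comm]

theorem sphereEnergy_add_right (V u : (Fin N → ℤ) → ℝ) (y : Fin N → ℤ) :
    sphereEnergy (fun x => V (x + y)) (fun x => u (x + y)) = sphereEnergy V u := by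
  unfold sphereEnergy
  rw [← (Equiv.addRight y).tsum_eq (fun x => ENNReal.ofReal (dens V u x))]
  simp only [dens, gradSq_add_right, Equiv.coe_addRight]

theorem hasSum_add_right {f : (Fin N → ℤ) → ℝ} {s : ℝ} (y : Fin N → ℤ) :
    HasSum (fun x => f (x + y)) s ↔ HasSum f s :=
  (Equiv.addRight y).hasSum_iff (f := f)

theorem sphereLevel_le {V u : (Fin N → ℤ) → ℝ} (h : HasSum (fun x => u x ^ 2) 1) :
    sphereLevel V ≤ sphereEnergy V u := iInf₂_le u h

theorem sphereLevel_add_right_le (V : (Fin N → ℤ) → ℝ) (y : Fin N → ℤ) :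
    sphereLevel V ≤ sphereLevel (fun x => V (x + y)) := by
  refine le_iInf₂ fun u hu => ?_
  have h1 : HasSum (fun x => (u (x + -y)) ^ 2) 1 := (hasSum_add_right (f := fun x => u x ^ 2) (-y)).2 hu
  refine (sphereLevel_le h1).trans_eq ?_
  rw [← sphereEnergy_add_right V _ y]
  simp

theorem gradSq_abs_le (u : (Fin N → ℤ) → ℝ) (x : Fin N → ℤ) :
    gradSq (fun x => |u x|) x ≤ gradSq u x := by
  simp only [gradSq_eq]
  exact mul_le_mul_of_nonneg_left (Finset.sum_le_sum fun d _ =>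
    sq_le_sq.2 (abs_abs_sub_abs_le (u (x + d)) (u x))) (by norm_num)

theorem sphereEnergy_abs_le (V u : (Fin N → ℤ) → ℝ) :
    sphereEnergy V (fun x => |u x|) ≤ sphereEnergy V u := by
  refine ENNReal.tsum_le_tsum fun x => ENNReal.ofReal_le_ofReal ?_
  simp only [dens, sq_abs]
  linarith [gradSq_abs_le u x]

theorem sphereEnergy_mono {V W : (Fin N → ℤ) → ℝ} (h : ∀ x, V x ≤ W x) (u : (Fin N → ℤ) → ℝ) :
    sphereEnergy V u ≤ sphereEnergy W u := by
  refine ENNReal.tsum_le_tsum fun x => ENNReal.ofReal_le_ofReal ?_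
  have := mul_le_mul_of_nonneg_right (h x) (sq_nonneg (u x))
  simp only [dens]; linarith

theorem hasSum_sq_smul {u : (Fin N → ℤ) → ℝ} {s : ℝ} (h : HasSum (fun x => u x ^ 2) s) (c : ℝ) :
    HasSum (fun x => (c • u) x ^ 2) (c ^ 2 * s) := by
  simpa [mul_pow] using h.mul_left (c ^ 2)

/-- The energy of the normalisation of `u` when `‖u‖² = s ≤ 1`. -/
theorem mul_sphereEnergy_smul_le (V : (Fin N → ℤ) → ℝ) {u : (Fin N → ℤ) → ℝ} {s : ℝ}
    (hs : 0 < s) (hs1 : s ≤ 1) :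
    ENNReal.ofReal s * sphereEnergy V ((√s)⁻¹ • u) ≤ sphereEnergy V u := by
  unfold sphereEnergy
  rw [← ENNReal.tsum_mul_left]
  refine ENNReal.tsum_le_tsum fun x => ?_
  rw [← ENNReal.ofReal_mul hs.le]
  refine ENNReal.ofReal_le_ofReal ?_
  have h := dens_smul V (√s) ((√s)⁻¹ • u) x
  rw [smul_smul, mul_inv_cancel₀ (Real.sqrt_pos.2 hs).ne', one_smul, Real.sq_sqrt hs.le] at h
  rw [h]
  -- Mass at most one makes the entropy correction nonnegative, so it can be dropped.
  have := mul_nonneg (Real.negMulLog_nonneg hs.le hs1) (sq_nonneg (((√s)⁻¹ • u) x))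
  linarith

theorem hasSum_sq_normalize {u : (Fin N → ℤ) → ℝ} {s : ℝ} (hs : 0 < s)
    (h : HasSum (fun x => u x ^ 2) s) : HasSum (fun x => ((√s)⁻¹ • u) x ^ 2) 1 := by
  have := hasSum_sq_smul h (√s)⁻¹
  rwa [inv_pow, Real.sq_sqrt hs.le, inv_mul_cancel₀ hs.ne'] at this

theorem sphereEnergy_eq_ofReal {V u : (Fin N → ℤ) → ℝ} (hV : ∀ x, -1 < V x)
    (hu : HasSum (fun x => u x ^ 2) 1) {k : ℝ} (h : HasSum (dens V u) k) :
    sphereEnergy V u = ENNReal.ofReal k := by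
  rw [sphereEnergy, ← h.tsum_eq, ENNReal.ofReal_tsum_of_nonneg
    (fun x => dens_nonneg hV (sq_le_of_hasSum hu x)) h.summable]

theorem hasSum_dens {V u : (Fin N → ℤ) → ℝ} (hV : ∀ x, -1 < V x)
    (hu : HasSum (fun x => u x ^ 2) 1) (h : sphereEnergy V u ≠ ⊤) :
    HasSum (dens V u) (sphereEnergy V u).toReal := by
  have h0 : ∀ x, 0 ≤ dens V u x := fun x => dens_nonneg hV (sq_le_of_hasSum hu x)
  have := ENNReal.hasSum_toReal h
  simpa [ENNReal.toReal_ofReal, h0, sphereEnergy, ENNReal.tsum_toReal_eq] using this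

/-- The lower bound for the energy of functions of arbitrary mass `s`. -/
theorem le_hasSum_dens {V u : (Fin N → ℤ) → ℝ} (hV : ∀ x, -1 < V x) {s k : ℝ} (hs : 0 < s)
    (hu : HasSum (fun x => u x ^ 2) s) (h : HasSum (dens V u) k) :
    s * (sphereLevel V).toReal + Real.negMulLog s ≤ k := by
  set v := (√s)⁻¹ • u with hv
  have hv1 : HasSum (fun x => v x ^ 2) 1 := hasSum_sq_normalize hs hu
  have huv : ∀ x, dens V u x = s * dens V v x + Real.negMulLog s * v x ^ 2 := by
    intro x
    have h := dens_smul V (√s) v x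
    rwa [hv, smul_smul, mul_inv_cancel₀ (Real.sqrt_pos.2 hs).ne', one_smul,
      Real.sq_sqrt hs.le] at h
  have h2 : HasSum (dens V v) (s⁻¹ * (k - Real.negMulLog s * 1)) := by
    refine ((h.sub (hv1.mul_left (Real.negMulLog s))).mul_left s⁻¹).congr_fun ?_
    intro x
    rw [huv x]; field_simp; ring
  have h0 : 0 ≤ s⁻¹ * (k - Real.negMulLog s * 1) :=
    h2.nonneg fun x => dens_nonneg hV (sq_le_of_hasSum hv1 x)
  have h3 := sphereLevel_le (V := V) hv1
  rw [sphereEnergy_eq_ofReal hV hv1 h2] at h3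
  have h4 := ENNReal.toReal_mono ENNReal.ofReal_ne_top h3
  rw [ENNReal.toReal_ofReal h0, ← div_eq_inv_mul, le_div_iff₀ hs] at h4
  linarith

/-! ### Splitting the energy along a finite set. -/

/-- The sites of `F` together with their neighbours. -/
def hull (F : Finset (Fin N → ℤ)) : Finset (Fin N → ℤ) :=
  F ∪ F.biUnion fun y => (steps N).image fun d => y + d

theorem subset_hull (F : Finset (Fin N → ℤ)) : F ⊆ hull F := Finset.subset_union_left

theorem add_mem_hull {F : Finset (Fin N → ℤ)} {x d : Fin N → ℤ} (hx : x ∈ F) (hd : d ∈ steps N) :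
    x + d ∈ hull F :=
  Finset.mem_union_right _ (Finset.mem_biUnion.2 ⟨x, hx, Finset.mem_image_of_mem _ hd⟩)

theorem mem_hull_of_add_mem {F : Finset (Fin N → ℤ)} {x d : Fin N → ℤ} (hx : x + d ∈ F)
    (hd : d ∈ steps N) : x ∈ hull F := by
  simpa using add_mem_hull hx (neg_mem_steps hd)

/-- The part of `u` inside `F`. -/
def inside (F : Finset (Fin N → ℤ)) (u : (Fin N → ℤ) → ℝ) : (Fin N → ℤ) → ℝ :=
  Set.indicator (F : Set (Fin N → ℤ)) u

/-- The part of `u` outside `F`. -/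
def outside (F : Finset (Fin N → ℤ)) (u : (Fin N → ℤ) → ℝ) : (Fin N → ℤ) → ℝ :=
  Set.indicator (F : Set (Fin N → ℤ))ᶜ u

theorem inside_of_mem {F : Finset (Fin N → ℤ)} {x : Fin N → ℤ} (h : x ∈ F)
    (u : (Fin N → ℤ) → ℝ) : inside F u x = u x := by simp [inside, h]

theorem inside_of_notMem {F : Finset (Fin N → ℤ)} {x : Fin N → ℤ} (h : x ∉ F)
    (u : (Fin N → ℤ) → ℝ) : inside F u x = 0 := by simp [inside, h]

theorem outside_of_mem {F : Finset (Fin N → ℤ)} {x : Fin N → ℤ} (h : x ∈ F)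
    (u : (Fin N → ℤ) → ℝ) : outside F u x = 0 := by simp [outside, h]

theorem outside_of_notMem {F : Finset (Fin N → ℤ)} {x : Fin N → ℤ} (h : x ∉ F)
    (u : (Fin N → ℤ) → ℝ) : outside F u x = u x := by simp [outside, h]

/-- Twice the interaction of the inner and the outer part of `u` in the gradient term. -/
def cross (F : Finset (Fin N → ℤ)) (u : (Fin N → ℤ) → ℝ) (x : Fin N → ℤ) : ℝ :=
  ∑ d ∈ steps N, (inside F u (x + d) * outside F u x + inside F u x * outside F u (x + d))

theorem gradSq_inside_add_outside (F : Finset (Fin N → ℤ)) (u : (Fin N → ℤ) → ℝ)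
    (x : Fin N → ℤ) :
    gradSq (inside F u) x + gradSq (outside F u) x = gradSq u x + cross F u x := by
  simp only [gradSq_eq, cross, Finset.mul_sum, ← Finset.sum_add_distrib]
  refine Finset.sum_congr rfl fun d _ => ?_
  by_cases h1 : x ∈ F <;> by_cases h2 : x + d ∈ F <;>
    simp only [h1, h2, not_false_eq_true, inside_of_mem, inside_of_notMem, outside_of_mem,
      outside_of_notMem] <;> ring

/-- The supports are disjoint, so potential and entropy split exactly; only the gradient couples the
two parts. -/
theorem dens_inside_add_outside (V : (Fin N → ℤ) → ℝ) (F : Finset (Fin N → ℤ))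
    (u : (Fin N → ℤ) → ℝ) (x : Fin N → ℤ) :
    dens V (inside F u) x + dens V (outside F u) x = dens V u x + cross F u x := by
  have h := gradSq_inside_add_outside F u x
  by_cases h1 : x ∈ F <;>
    simp only [dens, h1, not_false_eq_true, inside_of_mem, inside_of_notMem, outside_of_mem,
      outside_of_notMem] <;> simp <;> linarith

theorem cross_eq_zero {F : Finset (Fin N → ℤ)} {x : Fin N → ℤ} (h : x ∉ hull F)
    (u : (Fin N → ℤ) → ℝ) : cross F u x = 0 := by
  refine Finset.sum_eq_zero fun d hd => ?_
  rw [inside_of_notMem fun h' => h (mem_hull_of_add_mem h' hd),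
    inside_of_notMem fun h' => h (subset_hull F h')]
  simp

theorem dens_inside_eq_zero (V : (Fin N → ℤ) → ℝ) {F : Finset (Fin N → ℤ)} {x : Fin N → ℤ}
    (h : x ∉ hull F) (u : (Fin N → ℤ) → ℝ) : dens V (inside F u) x = 0 := by
  have h0 : inside F u x = 0 := inside_of_notMem (fun h' => h (subset_hull F h')) u
  have h1 : gradSq (inside F u) x = 0 := by
    rw [gradSq_eq, Finset.sum_eq_zero, mul_zero]
    intro d hd
    rw [h0, inside_of_notMem fun h' => h (mem_hull_of_add_mem h' hd)]
    simp
  simp [dens, h0, h1]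

theorem hasSum_sq_outside {u : (Fin N → ℤ) → ℝ} {s : ℝ} (h : HasSum (fun x => u x ^ 2) s)
    (F : Finset (Fin N → ℤ)) :
    HasSum (fun x => outside F u x ^ 2) (s - ∑ x ∈ F, u x ^ 2) := by
  have h1 : HasSum (fun x => inside F u x ^ 2) (∑ x ∈ F, u x ^ 2) := by
    rw [Finset.sum_congr rfl fun x hx => by rw [← inside_of_mem hx u]]
    exact hasSum_sum_of_ne_finset_zero fun x hx => by simp [inside_of_notMem hx]
  refine (h.sub h1).congr_fun fun x => ?_
  by_cases hx : x ∈ F <;>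
    simp [hx, inside_of_mem, inside_of_notMem, outside_of_mem, outside_of_notMem]

/-- The outer part has mass `s = 1 - ∑_F u²` and energy at least `s m`, because `-s log s ≥ 0`; the
inner part gets the rest. Only finitely many sites occur, so the bound survives pointwise limits. -/
theorem sum_dens_inside_le {V u : (Fin N → ℤ) → ℝ} (hV : ∀ x, -1 < V x)
    (hu : HasSum (fun x => u x ^ 2) 1) {k m : ℝ} (hk : HasSum (dens V u) k)
    (hm : m ≤ (sphereLevel V).toReal) (F : Finset (Fin N → ℤ)) :
    ∑ x ∈ hull F, dens V (inside F u) x ≤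
      k + ∑ x ∈ hull F, cross F u x - (1 - ∑ x ∈ F, u x ^ 2) * m := by
  have h1 : HasSum (dens V (inside F u)) (∑ x ∈ hull F, dens V (inside F u) x) :=
    hasSum_sum_of_ne_finset_zero fun x hx => dens_inside_eq_zero V hx u
  have h2 : HasSum (cross F u) (∑ x ∈ hull F, cross F u x) :=
    hasSum_sum_of_ne_finset_zero fun x hx => cross_eq_zero hx u
  have h3 : HasSum (dens V (outside F u))
      (k + ∑ x ∈ hull F, cross F u x - ∑ x ∈ hull F, dens V (inside F u) x) := by
    refine ((hk.add h2).sub h1).congr_fun fun x => ?_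
    linarith [dens_inside_add_outside V F u x]
  have h4 := hasSum_sq_outside hu F
  set s := 1 - ∑ x ∈ F, u x ^ 2 with hs
  have hs0 : 0 ≤ s := h4.nonneg fun x => sq_nonneg _
  have hs1 : s ≤ 1 := by
    have : 0 ≤ ∑ x ∈ F, u x ^ 2 := Finset.sum_nonneg fun x _ => sq_nonneg _
    linarith
  -- An outer part of mass zero cannot be normalised, but then nonnegativity of its energy is
  -- enough.
  rcases hs0.eq_or_lt with h0 | h0
  · have := h3.nonneg fun x => dens_nonneg hV ((sq_le_of_hasSum h4 x).trans hs1)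
    rw [← h0]; linarith
  · have h5 := le_hasSum_dens hV h0 h4 h3
    have h6 := Real.negMulLog_nonneg hs0 hs1
    have h7 := mul_le_mul_of_nonneg_left hm hs0
    linarith

/-! ### Passing to pointwise limits. -/

theorem tendsto_inside {ι : Type*} {l : Filter ι} {u : ι → (Fin N → ℤ) → ℝ}
    {w : (Fin N → ℤ) → ℝ} (hw : ∀ x, Tendsto (fun n => u n x) l (𝓝 (w x)))
    (F : Finset (Fin N → ℤ)) (x : Fin N → ℤ) :
    Tendsto (fun n => inside F (u n) x) l (𝓝 (inside F w x)) := by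
  by_cases hx : x ∈ F <;> simp [inside_of_mem, inside_of_notMem, hx, hw, tendsto_const_nhds]

theorem tendsto_outside {ι : Type*} {l : Filter ι} {u : ι → (Fin N → ℤ) → ℝ}
    {w : (Fin N → ℤ) → ℝ} (hw : ∀ x, Tendsto (fun n => u n x) l (𝓝 (w x)))
    (F : Finset (Fin N → ℤ)) (x : Fin N → ℤ) :
    Tendsto (fun n => outside F (u n) x) l (𝓝 (outside F w x)) := by
  by_cases hx : x ∈ F <;> simp [outside_of_mem, outside_of_notMem, hx, hw, tendsto_const_nhds]

theorem tendsto_cross {ι : Type*} {l : Filter ι} {u : ι → (Fin N → ℤ) → ℝ}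
    {w : (Fin N → ℤ) → ℝ} (hw : ∀ x, Tendsto (fun n => u n x) l (𝓝 (w x)))
    (F : Finset (Fin N → ℤ)) (x : Fin N → ℤ) :
    Tendsto (fun n => cross F (u n) x) l (𝓝 (cross F w x)) :=
  tendsto_finsetSum _ fun _ _ =>
    ((tendsto_inside hw F _).mul (tendsto_outside hw F _)).add
      ((tendsto_inside hw F _).mul (tendsto_outside hw F _))

theorem tendsto_dens {ι : Type*} {l : Filter ι} {V u : ι → (Fin N → ℤ) → ℝ}
    {W w : (Fin N → ℤ) → ℝ} (hW : ∀ x, Tendsto (fun n => V n x) l (𝓝 (W x)))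
    (hw : ∀ x, Tendsto (fun n => u n x) l (𝓝 (w x))) (x : Fin N → ℤ) :
    Tendsto (fun n => dens (V n) (u n) x) l (𝓝 (dens W w x)) := by
  simp only [dens, gradSq_eq]
  refine Tendsto.add (Tendsto.add ?_ (((hW x).add_const 1).mul ((hw x).pow 2))) ?_
  · exact (tendsto_finsetSum _ fun _ _ => ((hw _).sub (hw x)).pow 2).const_mul _
  · exact (Real.continuous_negMulLog.tendsto _).comp ((hw x).pow 2)

theorem sum_dens_inside_le_of_tendsto {ι : Type*} {l : Filter ι} [l.NeBot]
    {V u : ι → (Fin N → ℤ) → ℝ} {W w : (Fin N → ℤ) → ℝ} {k : ι → ℝ} {m : ℝ}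
    (hV : ∀ n x, -1 < V n x) (hu : ∀ n, HasSum (fun x => u n x ^ 2) 1)
    (hk : ∀ n, HasSum (dens (V n) (u n)) (k n)) (hm : ∀ n, m ≤ (sphereLevel (V n)).toReal)
    (hkm : Tendsto k l (𝓝 m)) (hW : ∀ x, Tendsto (fun n => V n x) l (𝓝 (W x)))
    (hw : ∀ x, Tendsto (fun n => u n x) l (𝓝 (w x))) (F : Finset (Fin N → ℤ)) :
    ∑ x ∈ hull F, dens W (inside F w) x ≤
      ∑ x ∈ hull F, cross F w x + m * ∑ x ∈ F, w x ^ 2 := by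
  have h1 : Tendsto (fun n => ∑ x ∈ hull F, dens (V n) (inside F (u n)) x) l
      (𝓝 (∑ x ∈ hull F, dens W (inside F w) x)) :=
    tendsto_finsetSum _ fun x _ => tendsto_dens hW (tendsto_inside hw F) x
  have h2 : Tendsto (fun n => k n + ∑ x ∈ hull F, cross F (u n) x -
      (1 - ∑ x ∈ F, u n x ^ 2) * m) l
      (𝓝 (m + ∑ x ∈ hull F, cross F w x - (1 - ∑ x ∈ F, w x ^ 2) * m)) :=
    (hkm.add (tendsto_finsetSum _ fun x _ => tendsto_cross hw F x)).sub
      (((tendsto_finsetSum _ fun x _ => (hw x).pow 2).const_sub 1).mul_const m)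
  have h3 := le_of_tendsto_of_tendsto' h1 h2 fun n =>
    sum_dens_inside_le (hV n) (hu n) (hk n) (hm n) F
  linarith

theorem summable_add_right {f : (Fin N → ℤ) → ℝ} (h : Summable f) (d : Fin N → ℤ) :
    Summable fun x => f (x + d) :=
  (Equiv.addRight d).summable_iff.2 h

theorem summable_sum_steps_sq {w : (Fin N → ℤ) → ℝ} (hw : Summable fun x => w x ^ 2) :
    Summable fun x => ∑ d ∈ steps N, (w (x + d) ^ 2 + w x ^ 2) :=
  summable_sum fun d _ => (summable_add_right hw d).add hw

theorem abs_cross_le (F : Finset (Fin N → ℤ)) (w : (Fin N → ℤ) → ℝ) (x : Fin N → ℤ) :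
    |cross F w x| ≤ ∑ d ∈ steps N, (w (x + d) ^ 2 + w x ^ 2) := by
  refine (Finset.abs_sum_le_sum_abs _ _).trans (Finset.sum_le_sum fun d _ => ?_)
  have h : |w (x + d) * w x| ≤ w (x + d) ^ 2 + w x ^ 2 := by
    rw [abs_le]
    constructor <;> nlinarith [sq_nonneg (w (x + d) + w x), sq_nonneg (w (x + d) - w x)]
  have h0 : 0 ≤ w (x + d) ^ 2 + w x ^ 2 := by positivity
  by_cases h1 : x ∈ F <;> by_cases h2 : x + d ∈ F <;>
    simp [h1, h2, inside_of_mem, inside_of_notMem, outside_of_mem, outside_of_notMem, h0,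
      -abs_mul, h, mul_comm (w x) (w (x + d))]

theorem cross_eq_zero_of_hull_subset {F : Finset (Fin N → ℤ)} {x : Fin N → ℤ}
    (h : hull {x} ⊆ F) (w : (Fin N → ℤ) → ℝ) : cross F w x = 0 := by
  have hx : x ∈ F := h (subset_hull _ (Finset.mem_singleton_self x))
  refine Finset.sum_eq_zero fun d hd => ?_
  rw [outside_of_mem hx, outside_of_mem (h (add_mem_hull (Finset.mem_singleton_self x) hd))]
  simp

theorem dens_inside_of_hull_subset (V : (Fin N → ℤ) → ℝ) {F : Finset (Fin N → ℤ)}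
    {x : Fin N → ℤ} (h : hull {x} ⊆ F) (w : (Fin N → ℤ) → ℝ) :
    dens V (inside F w) x = dens V w x := by
  have hx : x ∈ F := h (subset_hull _ (Finset.mem_singleton_self x))
  simp only [dens, gradSq_eq, inside_of_mem hx]
  rw [Finset.sum_congr rfl fun d hd => by
    rw [inside_of_mem (h (add_mem_hull (Finset.mem_singleton_self x) hd))]]

/-- Dominated convergence: the cross term at a site vanishes once `F` contains the site and its
neighbours, and the majorant in `abs_cross_le` does not depend on `F`. -/
theorem tendsto_sum_cross {w : (Fin N → ℤ) → ℝ} (hw : Summable fun x => w x ^ 2) :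
    Tendsto (fun F => ∑ x ∈ hull F, cross F w x) atTop (𝓝 0) := by
  have h := tendsto_tsum_of_dominated_convergence (𝓕 := (atTop : Filter (Finset (Fin N → ℤ))))
    (f := fun F x => cross F w x) (g := fun _ => 0) (summable_sum_steps_sq hw)
    (fun x => tendsto_const_nhds.congr' ?_) (Eventually.of_forall fun F x => abs_cross_le F w x)
  · simp only [tsum_zero] at h
    refine h.congr fun F => ?_
    exact tsum_eq_sum fun x hx => cross_eq_zero hx w
  · filter_upwards [eventually_ge_atTop (hull {x})] with F hF
    exact (cross_eq_zero_of_hull_subset hF w).symm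

theorem sq_inside_le (F : Finset (Fin N → ℤ)) (w : (Fin N → ℤ) → ℝ) (x : Fin N → ℤ) :
    inside F w x ^ 2 ≤ w x ^ 2 := by
  by_cases hx : x ∈ F <;> simp [inside_of_mem, inside_of_notMem, hx, sq_nonneg]

/-- Pointwise limits of minimising sequences have energy at most (level) × (mass). -/
theorem sphereEnergy_le_of_tendsto {ι : Type*} {l : Filter ι} [l.NeBot]
    {V u : ι → (Fin N → ℤ) → ℝ} {W w : (Fin N → ℤ) → ℝ} {k : ι → ℝ} {m : ℝ}
    (hV : ∀ n x, -1 < V n x) (hu : ∀ n, HasSum (fun x => u n x ^ 2) 1)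
    (hk : ∀ n, HasSum (dens (V n) (u n)) (k n)) (hm : ∀ n, m ≤ (sphereLevel (V n)).toReal)
    (hkm : Tendsto k l (𝓝 m)) (hWV : ∀ x, -1 < W x)
    (hW : ∀ x, Tendsto (fun n => V n x) l (𝓝 (W x)))
    (hw : ∀ x, Tendsto (fun n => u n x) l (𝓝 (w x))) :
    ∃ s ≤ 1, HasSum (fun x => w x ^ 2) s ∧ sphereEnergy W w ≤ ENNReal.ofReal (m * s) := by
  have hG : ∀ G : Finset (Fin N → ℤ), ∑ x ∈ G, w x ^ 2 ≤ 1 := fun G =>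
    le_of_tendsto' (tendsto_finsetSum G fun x _ => (hw x).pow 2) fun n =>
      sum_le_hasSum G (fun x _ => sq_nonneg _) (hu n)
  have hsum : Summable fun x => w x ^ 2 := summable_of_sum_le (fun x => sq_nonneg _) hG
  have hw1 : ∀ x, w x ^ 2 ≤ 1 := fun x => by simpa using hG {x}
  refine ⟨_, hsum.tsum_le_of_sum_le hG, hsum.hasSum, ?_⟩
  rw [sphereEnergy, ENNReal.tsum_eq_iSup_sum]
  refine iSup_le fun G => ?_
  rw [← ENNReal.ofReal_sum_of_nonneg fun x _ => dens_nonneg hWV (hw1 x)]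
  refine ENNReal.ofReal_le_ofReal ?_
  have hlim : Tendsto (fun F => ∑ x ∈ hull F, cross F w x + m * ∑ x ∈ F, w x ^ 2) atTop
      (𝓝 (0 + m * ∑' x, w x ^ 2)) :=
    (tendsto_sum_cross hsum).add (Tendsto.const_mul m hsum.hasSum)
  rw [zero_add] at hlim
  refine ge_of_tendsto hlim ?_
  -- For such `F`, truncation does not change the density on `G`; the remaining terms are
  -- nonnegative and are discarded.
  filter_upwards [eventually_ge_atTop (G.biUnion fun x => hull {x})] with F hF
  refine le_trans ?_ (sum_dens_inside_le_of_tendsto hV hu hk hm hkm hW hw F)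
  have hx : ∀ x ∈ G, hull {x} ⊆ F := fun x hx =>
    (Finset.subset_biUnion_of_mem (fun x => hull {x}) hx).trans hF
  rw [← Finset.sum_congr rfl fun x h => dens_inside_of_hull_subset W (hx x h) w]
  refine Finset.sum_le_sum_of_subset_of_nonneg (fun x h => ?_) fun x _ _ =>
    dens_nonneg hWV ((sq_inside_le F w x).trans (hw1 x))
  exact subset_hull F (hx x h (subset_hull _ (Finset.mem_singleton_self x)))

/-! ### Existence of a minimiser on the sphere. -/

theorem sphereLevel_ne_top (V : (Fin N → ℤ) → ℝ) : sphereLevel V ≠ ⊤ := by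
  have h1 : HasSum (fun x => inside {(0 : Fin N → ℤ)} (fun _ => (1 : ℝ)) x ^ 2) 1 := by
    refine (hasSum_ite_eq (0 : Fin N → ℤ) (1 : ℝ)).congr_fun fun x => ?_
    by_cases hx : x = 0 <;> simp [inside, hx]
  refine ne_top_of_le_ne_top ?_ (sphereLevel_le (V := V) h1)
  rw [sphereEnergy, tsum_eq_sum (s := hull {0}) fun x hx => by
    rw [dens_inside_eq_zero V hx, ENNReal.ofReal_zero]]
  exact ENNReal.sum_ne_top.2 fun x _ => ENNReal.ofReal_ne_top

/-- Functions of bounded energy on the sphere do not vanish uniformly. -/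
theorem exists_exp_le_sq {V u : (Fin N → ℤ) → ℝ} (hV : ∀ x, -1 < V x)
    (hu : HasSum (fun x => u x ^ 2) 1) {k : ℝ} (hk : HasSum (dens V u) k) :
    ∃ x, Real.exp (-(k + 1)) ≤ u x ^ 2 := by
  -- Otherwise `-log u² > k + 1` wherever `u ≠ 0`, and the entropy alone would be at least `k + 1`.
  by_contra! h
  have h1 : ∀ x, (k + 1) * u x ^ 2 ≤ dens V u x := by
    intro x
    have h2 := gradSq_nonneg u x
    have h3 : 0 ≤ (V x + 1) * u x ^ 2 := mul_nonneg (by linarith [hV x]) (sq_nonneg _)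
    have h4 : (k + 1) * u x ^ 2 ≤ Real.negMulLog (u x ^ 2) := by
      rcases (sq_nonneg (u x)).eq_or_lt with h0 | h0
      · simp [← h0]
      · have h5 := (Real.log_lt_iff_lt_exp h0).2 (h x)
        have := mul_le_mul_of_nonneg_right h5.le h0.le
        rw [Real.negMulLog]; linarith
    unfold dens; linarith
  have := hasSum_le h1 (hu.mul_left (k + 1)) hk
  linarith

theorem exists_minimizing_seq (V : (Fin N → ℤ) → ℝ) (hV : ∀ x, -1 < V x) :
    ∃ (u : ℕ → (Fin N → ℤ) → ℝ) (k : ℕ → ℝ), (∀ n x, 0 ≤ u n x) ∧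
      (∀ n, HasSum (fun x => u n x ^ 2) 1) ∧ (∀ n, HasSum (dens V (u n)) (k n)) ∧
      (∀ n, k n ≤ (sphereLevel V).toReal + 1 / ((n : ℝ) + 1)) ∧
      Tendsto k atTop (𝓝 (sphereLevel V).toReal) := by
  have h1 : ∀ n : ℕ, ∃ u : (Fin N → ℤ) → ℝ, (∀ x, 0 ≤ u x) ∧ HasSum (fun x => u x ^ 2) 1 ∧
      sphereEnergy V u ≤ sphereLevel V + ENNReal.ofReal (1 / ((n : ℝ) + 1)) := by
    intro n
    have : sphereLevel V < sphereLevel V + ENNReal.ofReal (1 / ((n : ℝ) + 1)) :=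
      ENNReal.lt_add_right (sphereLevel_ne_top V) (ENNReal.ofReal_pos.2 (by positivity)).ne'
    obtain ⟨u, hu⟩ := iInf_lt_iff.1 this
    obtain ⟨hu1, hu2⟩ := iInf_lt_iff.1 hu
    exact ⟨fun x => |u x|, fun x => abs_nonneg _, by simpa using hu1,
      (sphereEnergy_abs_le V u).trans hu2.le⟩
  choose u hu0 hu1 hu2 using h1
  have h2 : ∀ n, sphereEnergy V (u n) ≠ ⊤ := fun n =>
    ne_top_of_le_ne_top (ENNReal.add_ne_top.2 ⟨sphereLevel_ne_top V, ENNReal.ofReal_ne_top⟩) (hu2 n)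
  have h3 : ∀ n, (sphereEnergy V (u n)).toReal ≤ (sphereLevel V).toReal + 1 / ((n : ℝ) + 1) := by
    intro n
    have := ENNReal.toReal_mono
      (ENNReal.add_ne_top.2 ⟨sphereLevel_ne_top V, ENNReal.ofReal_ne_top⟩) (hu2 n)
    rwa [ENNReal.toReal_add (sphereLevel_ne_top V) ENNReal.ofReal_ne_top,
      ENNReal.toReal_ofReal (by positivity)] at this
  refine ⟨u, fun n => (sphereEnergy V (u n)).toReal, hu0, hu1,
    fun n => hasSum_dens hV (hu1 n) (h2 n), h3, ?_⟩
  refine tendsto_of_tendsto_of_tendsto_of_le_of_le tendsto_const_nhds ?_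
    (fun n => ENNReal.toReal_mono (h2 n) (sphereLevel_le (hu1 n))) h3
  simpa using tendsto_one_div_add_atTop_nhds_zero_nat.const_add (sphereLevel V).toReal

theorem comap_norm_atTop_eq_cofinite :
    comap (fun x : Fin N → ℤ => ‖x‖) atTop = cofinite := by
  rw [comap_norm_atTop, Metric.cobounded_eq_cocompact, cocompact_eq_cofinite]

/-- Translates of `V` have pointwise limits along ultrafilters, and these lie above a translate
of `V`. -/
theorem exists_limit_potential {T : ℕ} (hT : 1 ≤ T) {V Vp : (Fin N → ℤ) → ℝ}
    (hper : IsPeriodic T Vp) (hle : ∀ x, V x ≤ Vp x)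
    (hlim : Tendsto (fun x => |V x - Vp x|) cofinite (𝓝 0)) (U : Ultrafilter ℕ)
    (y : ℕ → Fin N → ℤ) :
    ∃ (r : Fin N → ℤ) (W : (Fin N → ℤ) → ℝ), (∀ x, V (x + r) ≤ W x) ∧
      ∀ x, Tendsto (fun n => V (x + y n)) U (𝓝 (W x)) := by
  -- An ultrafilter either fixes the centres at one site or pushes them out of every finite set.
  by_cases h : ∃ r, ∀ᶠ n in U, y n = r
  · obtain ⟨r, hr⟩ := h
    refine ⟨r, fun x => V (x + r), fun x => le_rfl, fun x => tendsto_const_nhds.congr' ?_⟩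
    filter_upwards [hr] with n hn
    rw [hn]
  · have hy : Tendsto y U cofinite := by
      rw [Tendsto, le_cofinite_iff_eventually_ne]
      intro r
      rw [eventually_map]
      exact Ultrafilter.eventually_not.2 fun h' => h ⟨r, h'⟩
    have : NeZero T := ⟨by omega⟩
    -- There are finitely many residue vectors modulo `T`, so the ultrafilter selects one; on that
    -- class `Vp (x + y n)` is independent of `n`.
    obtain ⟨c, hc⟩ := Ultrafilter.eq_pure_of_finite
      (U.map fun n => fun i => ((y n i : ℤ) : ZMod T))
    have hc' : ∀ᶠ n in U, (fun i => ((y n i : ℤ) : ZMod T)) = c := by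
      have : ({c} : Set (Fin N → ZMod T)) ∈ U.map fun n => fun i => ((y n i : ℤ) : ZMod T) := by
        rw [hc]; exact Set.mem_singleton c
      exact Ultrafilter.mem_map.1 this
    obtain ⟨n₀, hn₀⟩ := hc'.exists
    refine ⟨y n₀, fun x => Vp (x + y n₀), fun x => hle _, fun x => ?_⟩
    have h1 : Tendsto (fun n => x + y n) U cofinite :=
      (add_right_injective x).tendsto_cofinite.comp hy
    have h2 := ((tendsto_zero_iff_abs_tendsto_zero _).2 hlim).comp h1
    have h3 := h2.add_const (Vp (x + y n₀))
    rw [zero_add] at h3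
    refine h3.congr' ?_
    filter_upwards [hc'] with n hn
    have h4 : ∃ z : Fin N → ℤ, y n = y n₀ + (T : ℤ) • z := by
      have : ∀ i, (T : ℤ) ∣ y n i - y n₀ i := fun i =>
        (ZMod.intCast_eq_intCast_iff_dvd_sub _ _ _).1 (congrFun (hn₀.trans hn.symm) i)
      choose z hz using this
      refine ⟨z, funext fun i => ?_⟩
      simp [← hz]
    obtain ⟨z, hz⟩ := h4
    simp only [Function.comp_apply]
    rw [show x + y n = (x + y n₀) + (T : ℤ) • z by rw [hz, add_assoc], hper.add_smul]
    ring

theorem exists_minimizer {T : ℕ} (hT : 1 ≤ T) {V Vp : (Fin N → ℤ) → ℝ}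
    (hper : IsPeriodic T Vp) (hV : ∀ x, -1 < V x) (hle : ∀ x, V x ≤ Vp x)
    (hlim : Tendsto (fun x => |V x - Vp x|) cofinite (𝓝 0)) :
    ∃ v : (Fin N → ℤ) → ℝ, (∀ x, 0 ≤ v x) ∧ HasSum (fun x => v x ^ 2) 1 ∧
      HasSum (dens V v) (sphereLevel V).toReal := by
  set m := (sphereLevel V).toReal with hm
  have hm0 : 0 ≤ m := ENNReal.toReal_nonneg
  obtain ⟨u, k, hu0, hu1, hk, hkle, hkm⟩ := exists_minimizing_seq V hV
  have hk1 : ∀ n, k n ≤ m + 1 := by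
    intro n
    have : 1 / ((n : ℝ) + 1) ≤ 1 := by
      rw [div_le_one (by positivity)]
      linarith [n.cast_nonneg (α := ℝ)]
    linarith [hkle n]
  choose y hy using fun n => exists_exp_le_sq hV (hu1 n) (hk n)
  let U : Ultrafilter ℕ := hyperfilter ℕ
  have hU : (U : Filter ℕ) ≤ atTop := Nat.hyperfilter_le_atTop
  obtain ⟨r, W, hrW, hW⟩ := exists_limit_potential hT hper hle hlim U y
  have hWV : ∀ x, -1 < W x := fun x => (hV _).trans_le (hrW x)
  have hlimw : ∀ x, ∃ a, 0 ≤ a ∧ Tendsto (fun n => u n (x + y n)) U (𝓝 a) := by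
    intro x
    have hb : ∀ n, u n (x + y n) ∈ Set.Icc (0 : ℝ) 1 := fun n =>
      ⟨hu0 n _, by
        have := sq_le_of_hasSum (hu1 n) (x + y n)
        nlinarith [hu0 n (x + y n)]⟩
    obtain ⟨a, ha, ha'⟩ := isCompact_Icc.ultrafilter_le_nhds
      (U.map fun n => u n (x + y n)) (by
        rw [le_principal_iff]
        exact Filter.mem_map.2 (univ_mem' hb))
    exact ⟨a, ha.1, ha'⟩
  choose w hw0 hw using hlimw
  obtain ⟨s, hs1, hs, hEw⟩ := sphereEnergy_le_of_tendsto (l := (U : Filter ℕ))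
    (V := fun n x => V (x + y n)) (u := fun n x => u n (x + y n)) (m := m)
    (fun n x => hV _) (fun n => (hasSum_add_right (f := fun x => u n x ^ 2) (y n)).2 (hu1 n))
    (fun n => by
      refine ((hasSum_add_right (y n)).2 (hk n)).congr_fun fun x => ?_
      simp only [dens, gradSq_add_right])
    (fun n => ENNReal.toReal_mono (sphereLevel_ne_top _) (sphereLevel_add_right_le V (y n)))
    (hkm.mono_left hU) hWV hW hw
  -- The bound `k n ≤ m + 1` makes the lower bound at the centres uniform in `n`, so it passes to `w
  -- 0`.
  have hs0 : 0 < s := by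
    have h1 : Real.exp (-(m + 1 + 1)) ≤ w 0 ^ 2 := by
      refine ge_of_tendsto' ((hw 0).pow 2) fun n => ?_
      rw [zero_add]
      exact (Real.exp_le_exp.2 (by linarith [hk1 n])).trans (hy n)
    exact (Real.exp_pos _).trans_le (h1.trans (sq_le_of_hasSum hs 0))
  set v := (√s)⁻¹ • w with hv
  have hv1 : HasSum (fun x => v x ^ 2) 1 := hasSum_sq_normalize hs0 hs
  have hEv : sphereEnergy W v ≤ ENNReal.ofReal m := by
    have h1 := (mul_sphereEnergy_smul_le W hs0 hs1).trans hEw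
    rw [mul_comm m s, ENNReal.ofReal_mul hs0.le] at h1
    exact (ENNReal.mul_le_mul_iff_right (ENNReal.ofReal_pos.2 hs0).ne'
      ENNReal.ofReal_ne_top).1 h1
  have hv1' : HasSum (fun x => v (x + -r) ^ 2) 1 :=
    (hasSum_add_right (f := fun x => v x ^ 2) (-r)).2 hv1
  -- Shifting back by `r` compares `V` with `W`, since `V (x + r) ≤ W x`.
  have hle1 : sphereEnergy V (fun x => v (x + -r)) ≤ ENNReal.ofReal m := by
    rw [← sphereEnergy_add_right V _ r]
    simpa using (sphereEnergy_mono hrW v).trans hEv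
  have heq : sphereEnergy V (fun x => v (x + -r)) = sphereLevel V := by
    refine le_antisymm ?_ (sphereLevel_le hv1')
    rwa [hm, ENNReal.ofReal_toReal (sphereLevel_ne_top V)] at hle1
  refine ⟨fun x => v (x + -r), fun x => ?_, hv1', ?_⟩
  · exact mul_nonneg (inv_nonneg.2 (Real.sqrt_nonneg _)) (hw0 _)
  · have := hasSum_dens hV hv1' (by rw [heq]; exact sphereLevel_ne_top V)
    rwa [heq] at this

/-! ### The Euler–Lagrange equation. -/

/-- At `0` the difference quotient is `-2 t log t → 0`, matching the convention `0 log 0 = 0`. The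
Euler–Lagrange equation therefore also holds at zeros of `v`, where the positivity argument uses it.
-/
theorem hasDerivAt_negMulLog_sq (a : ℝ) :
    HasDerivAt (fun a => Real.negMulLog (a ^ 2)) (-2 * (a * Real.log (a ^ 2)) - 2 * a) a := by
  by_cases ha : a = 0
  · subst ha
    rw [hasDerivAt_iff_tendsto_slope_zero]
    have h : Tendsto (fun t : ℝ => -2 * (t * Real.log t)) (𝓝[≠] 0) (𝓝 (-2 * (0 * Real.log 0))) :=
      ((Real.continuous_mul_log.tendsto 0).const_mul _).mono_left nhdsWithin_le_nhds
    simp only [zero_mul, mul_zero, sub_zero] at h ⊢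
    refine h.congr' ?_
    filter_upwards [self_mem_nhdsWithin] with t ht
    have ht' : t ≠ 0 := ht
    simp only [Real.negMulLog, zero_add, smul_eq_mul, Real.log_pow]
    field_simp
    push_cast
    ring
  · have h := HasDerivAt.comp (h := fun b : ℝ => b ^ 2) a
      (Real.hasDerivAt_negMulLog (pow_ne_zero 2 ha)) (hasDerivAt_pow 2 a)
    refine h.congr_deriv ?_
    simp only [Nat.cast_ofNat, Nat.add_one_sub_one, pow_one]
    ring

theorem gradSq_le (u : (Fin N → ℤ) → ℝ) (x : Fin N → ℤ) :
    gradSq u x ≤ ∑ d ∈ steps N, (u (x + d) ^ 2 + u x ^ 2) := by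
  rw [gradSq_eq, Finset.mul_sum]
  exact Finset.sum_le_sum fun d _ => by nlinarith [sq_nonneg (u (x + d) + u x)]

theorem summable_gradSq {u : (Fin N → ℤ) → ℝ} (h : Summable fun x => u x ^ 2) :
    Summable (gradSq u) :=
  (summable_sum_steps_sq h).of_nonneg_of_le (gradSq_nonneg u) (gradSq_le u)

theorem hasSum_mul_single (f : (Fin N → ℤ) → ℝ) (z : Fin N → ℤ) :
    HasSum (fun x => f x * (Pi.single z 1 : (Fin N → ℤ) → ℝ) x) (f z) := by
  refine (hasSum_ite_eq z (f z)).congr_fun fun x => ?_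
  by_cases h : x = z
  · subst h; simp
  · simp [h]

/-- Green's formula against a point mass. -/
theorem hasSum_grad_mul_grad_single (v : (Fin N → ℤ) → ℝ) (z : Fin N → ℤ) :
    HasSum (fun x => ∑ d ∈ steps N, (v (x + d) - v x) *
      ((Pi.single z 1 : (Fin N → ℤ) → ℝ) (x + d) - (Pi.single z 1 : (Fin N → ℤ) → ℝ) x))
      (-2 * laplacian v z) := by
  have h1 : ∀ d ∈ steps N, HasSum (fun x => (v (x + d) - v x) *
      ((Pi.single z 1 : (Fin N → ℤ) → ℝ) (x + d) - (Pi.single z 1 : (Fin N → ℤ) → ℝ) x))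
      ((v z - v (z + -d)) - (v (z + d) - v z)) := by
    intro d _
    have h2 := (hasSum_add_right d).2 (hasSum_mul_single (fun x => v x - v (x + -d)) z)
    have h3 := hasSum_mul_single (fun x => v (x + d) - v x) z
    refine (h2.sub h3).congr_fun fun x => ?_
    simp only [add_neg_cancel_right]
    ring
  have h2 := hasSum_sum h1
  rwa [Finset.sum_sub_distrib, sum_steps_neg fun d => v z - v (z + d), ← Finset.sum_sub_distrib,
    Finset.sum_congr rfl (g := fun d => -2 * (v (z + d) - v z)) fun d _ => by ring,
    ← Finset.mul_sum, ← laplacian_eq] at h2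

/-- A change at one site affects potential and entropy only there, and the gradient quadratically;
the energy becomes explicit in `t`, and no infinite sum has to be differentiated. -/
theorem hasSum_dens_add_single {V v : (Fin N → ℤ) → ℝ} {m : ℝ} (h : HasSum (dens V v) m)
    (z : Fin N → ℤ) (t : ℝ) :
    HasSum (dens V (v + t • Pi.single z 1))
      (m + t * (-2 * laplacian v z) + t ^ 2 * ∑' x, gradSq (Pi.single z (1 : ℝ)) x +
        (((V z + 1) * (v z + t) ^ 2 + Real.negMulLog ((v z + t) ^ 2)) -
          ((V z + 1) * v z ^ 2 + Real.negMulLog (v z ^ 2)))) := by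
  have h1 : Summable (gradSq (Pi.single z (1 : ℝ))) := by
    refine summable_gradSq (summable_of_hasFiniteSupport ((Set.finite_singleton z).subset ?_))
    intro x hx
    by_contra hxz
    simp [show x ≠ z from hxz] at hx
  have h2 := hasSum_mul_single (fun x => ((V x + 1) * (v x + t) ^ 2 +
    Real.negMulLog ((v x + t) ^ 2)) - ((V x + 1) * v x ^ 2 + Real.negMulLog (v x ^ 2))) z
  refine (((h.add ((hasSum_grad_mul_grad_single v z).mul_left t)).add
    (h1.hasSum.mul_left (t ^ 2))).add h2).congr_fun fun x => ?_
  have h3 : gradSq (v + t • Pi.single z 1) x = gradSq v x + t * ∑ d ∈ steps N, (v (x + d) - v x) *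
      ((Pi.single z 1 : (Fin N → ℤ) → ℝ) (x + d) - (Pi.single z 1 : (Fin N → ℤ) → ℝ) x) +
      t ^ 2 * gradSq (Pi.single z (1 : ℝ)) x := by
    simp only [gradSq_eq, Finset.mul_sum, ← Finset.sum_add_distrib]
    refine Finset.sum_congr rfl fun d _ => ?_
    simp only [Pi.add_apply, Pi.smul_apply, smul_eq_mul]
    ring
  rw [dens, h3, dens]
  by_cases hx : x = z
  · subst hx; simp; ring
  · simp [hx]; ring

theorem hasSum_sq_add_single {v : (Fin N → ℤ) → ℝ} (h : HasSum (fun x => v x ^ 2) 1)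
    (z : Fin N → ℤ) (t : ℝ) :
    HasSum (fun x => (v + t • Pi.single z 1 : (Fin N → ℤ) → ℝ) x ^ 2)
      (1 + ((v z + t) ^ 2 - v z ^ 2)) := by
  refine (h.add (hasSum_mul_single (fun x => (v x + t) ^ 2 - v x ^ 2) z)).congr_fun fun x => ?_
  by_cases hx : x = z
  · subst hx; simp
  · simp [hx]

/-- The Euler–Lagrange equation of a minimiser on the unit sphere. -/
theorem euler_lagrange {V v : (Fin N → ℤ) → ℝ} (hV : ∀ x, -1 < V x)
    (hv : HasSum (fun x => v x ^ 2) 1) (hm : HasSum (dens V v) (sphereLevel V).toReal)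
    (z : Fin N → ℤ) :
    -laplacian v z + V z * v z =
      v z * Real.log (v z ^ 2) + ((sphereLevel V).toReal - 1) * v z := by
  set m := (sphereLevel V).toReal
  set c := ∑' x, gradSq (Pi.single z (1 : ℝ)) x
  set a := v z with ha
  -- `s t` is the mass of the perturbed function, and `f t` its energy minus the lower bound at that
  -- mass. Having the bound at every mass avoids normalising competitors.
  let s : ℝ → ℝ := fun t => 1 + ((a + t) ^ 2 - a ^ 2)
  let f : ℝ → ℝ := fun t => (m + t * (-2 * laplacian v z) + t ^ 2 * c +
    (((V z + 1) * (a + t) ^ 2 + Real.negMulLog ((a + t) ^ 2)) -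
      ((V z + 1) * a ^ 2 + Real.negMulLog (a ^ 2)))) - (s t * m + Real.negMulLog (s t))
  have hs0 : s 0 = 1 := by simp [s]
  have hf0 : f 0 = 0 := by simp [f, hs0]
  have hs : HasDerivAt s (2 * a) 0 := by
    have h := ((((hasDerivAt_id (0 : ℝ)).const_add a).pow 2).sub_const (a ^ 2)).const_add 1
    refine h.congr_deriv ?_
    simp
  have hmin : IsLocalMin f 0 := by
    have h1 : ∀ᶠ t in 𝓝 (0 : ℝ), 0 < s t :=
      hs.continuousAt.eventually (lt_mem_nhds (by rw [hs0]; exact one_pos))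
    filter_upwards [h1] with t ht
    rw [hf0]
    exact sub_nonneg.2 (le_hasSum_dens hV ht (hasSum_sq_add_single hv z t)
      (hasSum_dens_add_single hm z t))
  have hid := hasDerivAt_id (0 : ℝ)
  have hsq : HasDerivAt (fun t => (a + t) ^ 2) (2 * a) 0 :=
    ((hid.const_add a).pow 2).congr_deriv (by simp)
  have hlog : HasDerivAt (fun t => Real.negMulLog ((a + t) ^ 2))
      (-2 * (a * Real.log (a ^ 2)) - 2 * a) 0 := by
    have h0 : HasDerivAt (fun b => Real.negMulLog (b ^ 2))
      (-2 * (a * Real.log (a ^ 2)) - 2 * a) (a + 0) := by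
      rw [add_zero]; exact hasDerivAt_negMulLog_sq a
    exact (h0.comp_const_add a 0)
  have hnl : HasDerivAt (fun t => Real.negMulLog (s t)) ((-Real.log 1 - 1) * (2 * a)) 0 := by
    have h0 : HasDerivAt Real.negMulLog (-Real.log 1 - 1) (s 0) := by
      rw [hs0]; exact Real.hasDerivAt_negMulLog one_ne_zero
    exact h0.comp 0 hs
  have hf := ((((hid.mul_const (-2 * laplacian v z)).const_add m).add
    ((hid.pow 2).mul_const c)).add
    (((hsq.const_mul (V z + 1)).add hlog).sub_const ((V z + 1) * a ^ 2 + Real.negMulLog (a ^ 2)))).sub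
    ((hs.mul_const m).add hnl)
  have h := hmin.hasDerivAt_eq_zero (hf : HasDerivAt f _ 0)
  norm_num [-Real.log_pow] at h
  linarith

/-! ### `H¹`, the domain of the energy and the Nehari manifold. -/

theorem summable_of_tsum_ofReal_lt_top {α : Type*} {f : α → ℝ} (h0 : ∀ x, 0 ≤ f x)
    (h : ∑' x, ENNReal.ofReal (f x) < ⊤) : Summable f := by
  simpa [ENNReal.toReal_ofReal, h0] using ENNReal.summable_toReal h.ne

theorem tsum_ofReal_lt_top {α : Type*} {f : α → ℝ} (h0 : ∀ x, 0 ≤ f x)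
    (h : Summable f) : ∑' x, ENNReal.ofReal (f x) < ⊤ := by
  rw [← ENNReal.ofReal_tsum_of_nonneg h0 h]
  exact ENNReal.ofReal_lt_top

theorem MemH1.summable_sq {u : (Fin N → ℤ) → ℝ} (h : MemH1 u) : Summable fun x => u x ^ 2 := by
  obtain ⟨φ, hφ, h1⟩ := h 1 one_pos
  have h2 : Summable fun x => gradSq (u - φ) x + (u - φ) x ^ 2 :=
    summable_of_tsum_ofReal_lt_top (fun x => add_nonneg (gradSq_nonneg _ _) (sq_nonneg _))
      (h1.trans ENNReal.one_lt_top)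
  have h3 : Summable fun x => φ x ^ 2 :=
    summable_of_hasFiniteSupport (hφ.subset fun x hx => by
      contrapose! hx; simpa using hx)
  refine ((h2.mul_left 2).add (h3.mul_left 2)).of_nonneg_of_le (fun x => sq_nonneg _) fun x => ?_
  have h4 := gradSq_nonneg (u - φ) x
  simp only [Pi.sub_apply] at h4 ⊢
  nlinarith [sq_nonneg (u x - 2 * φ x)]

/-- Degrees are bounded, so the `ℓ²` norm controls the gradient and finite truncations converge in
`H¹`. -/
theorem memH1_of_summable {u : (Fin N → ℤ) → ℝ} (h : Summable fun x => u x ^ 2) : MemH1 u := by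
  intro ε hε
  -- Each step contributes at most two copies of the mass to the gradient, and the square term one
  -- more.
  have h1 : ∀ F : Finset (Fin N → ℤ), h1NormSq (outside F u) ≤
      ENNReal.ofReal ((∑' x, u x ^ 2 - ∑ x ∈ F, u x ^ 2) * (2 * (steps N).card + 1)) := by
    intro F
    have hb := hasSum_sq_outside h.hasSum F
    set b := outside F u
    have h2 : HasSum (fun x => ∑ d ∈ steps N, (b (x + d) ^ 2 + b x ^ 2) + b x ^ 2)
        ((∑' x, u x ^ 2 - ∑ x ∈ F, u x ^ 2) * (2 * (steps N).card + 1)) := by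
      have h3 := (hasSum_sum (s := steps N) fun d _ =>
        ((hasSum_add_right (f := fun x => b x ^ 2) d).2 hb).add hb).add hb
      convert h3 using 1
      simp only [Finset.sum_const, nsmul_eq_mul]
      ring
    rw [← h2.tsum_eq, ENNReal.ofReal_tsum_of_nonneg (fun x => by positivity) h2.summable]
    refine ENNReal.tsum_le_tsum fun x => ENNReal.ofReal_le_ofReal ?_
    linarith [gradSq_le b x]
  have h2 : Tendsto (fun F : Finset (Fin N → ℤ) => ENNReal.ofReal
      ((∑' x, u x ^ 2 - ∑ x ∈ F, u x ^ 2) * (2 * (steps N).card + 1))) atTop (𝓝 0) := by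
    have h3 : Tendsto (fun F : Finset (Fin N → ℤ) => ∑ x ∈ F, u x ^ 2) atTop
      (𝓝 (∑' x, u x ^ 2)) := h.hasSum
    have h4 := ENNReal.tendsto_ofReal
      ((h3.const_sub (∑' x, u x ^ 2)).mul_const (2 * ((steps N).card : ℝ) + 1))
    simpa using h4
  obtain ⟨F, hF⟩ := (h2.eventually (gt_mem_nhds hε)).exists
  refine ⟨inside F u, F.finite_toSet.subset fun x hx => ?_, ?_⟩
  · contrapose! hx
    simpa using inside_of_notMem hx u
  · have : u - inside F u = outside F u := by
      ext x
      by_cases hx : x ∈ F <;>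
        simp [hx, inside_of_mem, inside_of_notMem, outside_of_mem, outside_of_notMem]
    rw [this]
    exact (h1 F).trans_lt hF

theorem mem_domain_iff {V u : (Fin N → ℤ) → ℝ} (hV : ∀ x, -1 < V x) :
    u ∈ domain V ↔ (Summable fun x => u x ^ 2) ∧ (Summable fun x => (V x + 1) * u x ^ 2) ∧
      Summable fun x => u x ^ 2 * Real.log (u x ^ 2) := by
  have h0 : ∀ x, 0 ≤ (V x + 1) * u x ^ 2 := fun x =>
    mul_nonneg (by linarith [hV x]) (sq_nonneg _)
  constructor
  · rintro ⟨hX, hE⟩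
    refine ⟨hX.1.summable_sq, summable_of_tsum_ofReal_lt_top h0 hX.2, ?_⟩
    by_contra h
    rw [energy, if_neg fun h' => h h'.2] at hE
    exact lt_irrefl _ hE
  · rintro ⟨h1, h2, h3⟩
    have hX : MemX V u := ⟨memH1_of_summable h1, tsum_ofReal_lt_top h0 h2⟩
    refine ⟨hX, ?_⟩
    rw [energy, if_pos ⟨hX, h3⟩]
    exact EReal.coe_lt_top _

theorem summable_dens_of_mem_domain {V u : (Fin N → ℤ) → ℝ} (hV : ∀ x, -1 < V x)
    (h : u ∈ domain V) : Summable (dens V u) := by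
  obtain ⟨h1, h2, h3⟩ := (mem_domain_iff hV).1 h
  refine (((summable_gradSq h1).add h2).sub h3).congr fun x => ?_
  simp only [dens, Real.negMulLog]
  ring

theorem energy_eq {V u : (Fin N → ℤ) → ℝ} (hV : ∀ x, -1 < V x) (h : u ∈ domain V) :
    energy V u = ((1 / 2 * ∑' x, dens V u x : ℝ) : EReal) := by
  obtain ⟨h1, h2, h3⟩ := (mem_domain_iff hV).1 h
  rw [energy, if_pos ⟨h.1, h3⟩, ← mul_sub, ← ((summable_gradSq h1).add h2).tsum_sub h3]
  congr! 4 with x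
  simp only [dens, Real.negMulLog]
  ring

/-- The pairing has `V` where the density has `V + 1`, which accounts for the subtracted mass. -/
theorem derivPairing_eq {V u : (Fin N → ℤ) → ℝ} (hV : ∀ x, -1 < V x) (h : u ∈ domain V) :
    derivPairing V u = ∑' x, dens V u x - ∑' x, u x ^ 2 := by
  obtain ⟨h1, h2, h3⟩ := (mem_domain_iff hV).1 h
  have h4 : Summable fun x => gradSq u x + V x * u x ^ 2 :=
    (((summable_gradSq h1).add h2).sub h1).congr fun x => by ring
  rw [derivPairing, ← h4.tsum_sub h3, ← (summable_dens_of_mem_domain hV h).tsum_sub h1]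
  congr! 2 with x
  simp only [dens, Real.negMulLog]
  ring

theorem energy_of_mem_nehari {V u : (Fin N → ℤ) → ℝ} (hV : ∀ x, -1 < V x) (h : u ∈ nehari V) :
    energy V u = ((1 / 2 * ∑' x, u x ^ 2 : ℝ) : EReal) := by
  have h1 := h.2.2
  rw [derivPairing_eq hV h.1, sub_eq_zero] at h1
  rw [energy_eq hV h.1, h1]

/-- At Nehari points `E` equals the mass `s`, so `s m - s log s ≤ s`; divide by `s`. -/
theorem exp_le_of_mem_nehari {V u : (Fin N → ℤ) → ℝ} (hV : ∀ x, -1 < V x) (h : u ∈ nehari V) :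
    Real.exp ((sphereLevel V).toReal - 1) ≤ ∑' x, u x ^ 2 := by
  have h1 := h.2.2
  rw [derivPairing_eq hV h.1, sub_eq_zero] at h1
  have hs := ((mem_domain_iff hV).1 h.1).1
  have hd := (summable_dens_of_mem_domain hV h.1).hasSum
  rw [h1] at hd
  have hpos : 0 < ∑' x, u x ^ 2 := by
    obtain ⟨x, hx⟩ := Function.ne_iff.1 h.2.1
    exact hs.tsum_pos (fun x => sq_nonneg _) x (sq_pos_of_ne_zero hx)
  have h2 := le_hasSum_dens hV hpos hs.hasSum hd
  set s := ∑' x, u x ^ 2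
  rw [← Real.le_log_iff_exp_le hpos]
  rw [Real.negMulLog] at h2
  by_contra! h3
  have := mul_lt_mul_of_pos_left h3 hpos
  linarith

theorem mem_domain_of_minimizer {V v : (Fin N → ℤ) → ℝ} (hV : ∀ x, -1 < V x)
    (hv : HasSum (fun x => v x ^ 2) 1) (hd : Summable (dens V v)) : v ∈ domain V := by
  have h0 : ∀ x, 0 ≤ (V x + 1) * v x ^ 2 := fun x =>
    mul_nonneg (by linarith [hV x]) (sq_nonneg _)
  have h2 : Summable fun x => (V x + 1) * v x ^ 2 := by
    refine hd.of_nonneg_of_le h0 fun x => ?_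
    have h1 := gradSq_nonneg v x
    have h3 := Real.negMulLog_nonneg (sq_nonneg (v x)) (sq_le_of_hasSum hv x)
    unfold dens; linarith
  refine (mem_domain_iff hV).2 ⟨hv.summable, h2, ?_⟩
  refine (((summable_gradSq hv.summable).add h2).sub hd).congr fun x => ?_
  simp only [dens, Real.negMulLog]
  ring

theorem smul_mem_domain {V v : (Fin N → ℤ) → ℝ} (hV : ∀ x, -1 < V x) (h : v ∈ domain V) (c : ℝ) :
    c • v ∈ domain V := by
  obtain ⟨h1, h2, h3⟩ := (mem_domain_iff hV).1 h
  refine (mem_domain_iff hV).2 ⟨?_, ?_, ?_⟩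
  · exact (h1.mul_left (c ^ 2)).congr fun x => by simp [mul_pow]
  · exact (h2.mul_left (c ^ 2)).congr fun x => by simp [mul_pow]; ring
  · refine ((h3.mul_left (c ^ 2)).add (h1.mul_left (c ^ 2 * Real.log (c ^ 2)))).congr fun x => ?_
    have h4 := Real.negMulLog_mul (c ^ 2) (v x ^ 2)
    simp only [Real.negMulLog] at h4
    simp only [Pi.smul_apply, smul_eq_mul, mul_pow]
    linarith

/-! ### Positivity and the ground state. -/

/-- A nonnegative minimiser is positive. -/
theorem pos_of_euler_lagrange {V v : (Fin N → ℤ) → ℝ} {c : ℝ} (hv0 : ∀ x, 0 ≤ v x) (hv : v ≠ 0)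
    (h : ∀ z, -laplacian v z + V z * v z = v z * Real.log (v z ^ 2) + c * v z)
    (x : Fin N → ℤ) : 0 < v x := by
  refine (hv0 x).lt_of_ne' fun hx => hv (funext fun z => ?_)
  refine forall_of_steps (p := fun x => v x = 0) (fun y hy d hd => ?_) hx z
  -- At a zero only the sum over the neighbours survives, and its terms are nonnegative.
  have h1 := h y
  simp only [hy, laplacian_eq, sub_zero, mul_zero, zero_mul, add_zero, neg_eq_zero] at h1
  exact (Finset.sum_eq_zero_iff_of_nonneg fun d _ => hv0 _).1 h1 d hd

/-- The factor satisfies `c² m - c² log c² = c²`, the Nehari condition for `c • v`; the same `log c²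
= m - 1` cancels the multiplier in the Euler–Lagrange equation. -/
theorem isGroundState_of_minimizer {V v : (Fin N → ℤ) → ℝ} (hV : ∀ x, -1 < V x)
    (hv : HasSum (fun x => v x ^ 2) 1) (hm : HasSum (dens V v) (sphereLevel V).toReal) :
    IsGroundState V (Real.exp (((sphereLevel V).toReal - 1) / 2) • v) := by
  have hEL := euler_lagrange hV hv hm
  set m := (sphereLevel V).toReal with hmdef
  set c := Real.exp ((m - 1) / 2) with hc
  have hc0 : 0 < c := Real.exp_pos _
  have hc2 : c ^ 2 = Real.exp (m - 1) := by
    rw [hc, ← Real.exp_nat_mul]; congr 1; push_cast; ring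
  have hdom := smul_mem_domain hV (mem_domain_of_minimizer hV hv hm.summable) c
  have hsq : HasSum (fun x => (c • v) x ^ 2) (c ^ 2) := by simpa using hasSum_sq_smul hv c
  have hdens : HasSum (dens V (c • v)) (c ^ 2) := by
    have h1 := (hm.mul_left (c ^ 2)).add (hv.mul_left (Real.negMulLog (c ^ 2)))
    have h2 : c ^ 2 * m + Real.negMulLog (c ^ 2) * 1 = c ^ 2 := by
      rw [Real.negMulLog, hc2, Real.log_exp]; ring
    rw [h2] at h1
    exact h1.congr_fun fun x => dens_smul V c v x
  have hne : c • v ≠ 0 := by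
    intro h
    simp only [h, Pi.zero_apply, ne_eq, OfNat.ofNat_ne_zero, not_false_eq_true, zero_pow] at hsq
    exact (pow_pos hc0 2).ne (hasSum_zero.unique hsq)
  have hneh : c • v ∈ nehari V :=
    ⟨hdom, hne, by rw [derivPairing_eq hV hdom, hdens.tsum_eq, hsq.tsum_eq, sub_self]⟩
  refine ⟨fun x => ?_, hneh, le_antisymm (le_iInf₂ fun w hw => ?_) (iInf₂_le _ hneh)⟩
  · have hlap : laplacian (c • v) x = c * laplacian v x := by
      simp only [laplacian_eq, Pi.smul_apply, smul_eq_mul, ← mul_sub, Finset.mul_sum]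
    have hlog : v x * Real.log (c ^ 2 * v x ^ 2) = v x * Real.log (v x ^ 2) + (m - 1) * v x := by
      by_cases h0 : v x = 0
      · simp [h0]
      · rw [Real.log_mul (pow_pos hc0 2).ne' (pow_ne_zero 2 h0), hc2, Real.log_exp]; ring
    rw [hlap]
    simp only [Pi.smul_apply, smul_eq_mul, mul_pow]
    linear_combination c * hEL x - c * hlog
  · rw [energy_of_mem_nehari hV hneh, energy_of_mem_nehari hV hw, hsq.tsum_eq, hc2,
      EReal.coe_le_coe_iff]
    linarith [exp_le_of_mem_nehari hV hw]

end LogSchrodinger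

end

theorem theorem1p3 (N T : ℕ) (hT : 1 ≤ T) (V Vp : (Fin N → ℤ) → ℝ)
    (hper : LogSchrodinger.IsPeriodic T Vp)
    (hbdd : BddBelow (Set.range V)) (hinf : -1 < ⨅ x, V x)
    (hle : ∀ x, V x ≤ Vp x)
    (hlim : Filter.Tendsto (fun x => |V x - Vp x|)
      (Filter.comap (fun x : Fin N → ℤ => ‖x‖) Filter.atTop) (nhds 0)) :
    ∃ u : (Fin N → ℤ) → ℝ, LogSchrodinger.IsGroundState V u ∧
      ((∀ x, 0 < u x) ∨ (∀ x, u x < 0)) := by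
  have hV : ∀ x, -1 < V x := fun x => hinf.trans_le (ciInf_le hbdd x)
  rw [LogSchrodinger.comap_norm_atTop_eq_cofinite] at hlim
  obtain ⟨v, hv0, hv, hm⟩ := LogSchrodinger.exists_minimizer hT hper hV hle hlim
  have hne : v ≠ 0 := by
    rintro rfl
    simp only [Pi.zero_apply, ne_eq, OfNat.ofNat_ne_zero, not_false_eq_true, zero_pow] at hv
    exact one_ne_zero (hv.unique hasSum_zero)
  have hpos := LogSchrodinger.pos_of_euler_lagrange hv0 hne
    (LogSchrodinger.euler_lagrange hV hv hm)
  exact ⟨_, LogSchrodinger.isGroundState_of_minimizer hV hv hm,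
    Or.inl fun x => mul_pos (Real.exp_pos _) (hpos x)⟩
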